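/- For polynomials $p, q \in \mathbb{C}[x,y]$ let $\deg$ denote the total degree and let $D(p,q) = \frac{\partial p}{\partial x}\frac{\partial q}{\partial y} - \frac{\partial p}{\partial y}\frac{\partial q}{\partial x}$ be the determinant of the Jacobian matrix of $(p,q)$. Call the pair $(p,q)$ elementary reduced if the sum $\deg p + \deg q$ cannot be made smaller by a single transformation of one of the following kinds: a non-degenerate linear transformation $(p,q) \mapsto (ap+bq,\, cp+dq)$ with $a,b,c,d \in \mathbb{C}$, $ad-bc \neq 0$; a transformation $(p,q) \mapsto (p + \mu q^{j},\, q)$ with $\mu \in \mathbb{C}^\ast$, $j \geq 2$; or a transformation $(p,q) \mapsto (p,\, q + \mu p^{j})$ with $\mu \in \mathbb{C}^\ast$, $j \geq 2$. Lemma. Let $p, q \in \mathbb{C}[x,y]$ be algebraically independent over $\mathbb{C}$ such that the pair $(p,q)$ is elementary reduced. Let $n = \deg p$ and $m = \deg q$ with $2 \leq n < m$, and let $k \geq 0$ be an integer with $\deg D(p,q) \geq k$. Let $w \in \mathbb{C}[p,q]$, and suppose that $w$ is not of the form $ap + bq + c$ with $a, b, c \in \mathbb{C}$. Then $\deg w >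 \min(n,k)$. -/

import Mathlib

open MvPolynomial

/-- The determinant `D(p, q)` of the Jacobian matrix of the pair `(p, q)` of polynomials in two
variables (`x = X 0`, `y = X 1`). -/
noncomputable def jacobianDet {K : Type*} [Field K] (p q : MvPolynomial (Fin 2) K) :
    MvPolynomial (Fin 2) K :=
  Matrix.det !![pderiv 0 p, pderiv 1 p; pderiv 0 q, pderiv 1 q]

/-- One admissible transformation `(p, q) ⟶ (p', q')`: a non-degenerate linear transformation, or
an elementary transformation adding to one entry a nonzero multiple of a power (exponent at
least 2) of the other entry. -/
inductive ElementaryStep {K : Type*} [Field K] :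
    MvPolynomial (Fin 2) K × MvPolynomial (Fin 2) K →
    MvPolynomial (Fin 2) K × MvPolynomial (Fin 2) K → Prop
  | linear (p q : MvPolynomial (Fin 2) K) (a b c d : K) (h : a * d - b * c ≠ 0) :
      ElementaryStep (p, q) (a • p + b • q, c • p + d • q)
  | left (p q : MvPolynomial (Fin 2) K) (μ : K) (hμ : μ ≠ 0) (k : ℕ) (hk : 2 ≤ k) :
      ElementaryStep (p, q) (p + μ • q ^ k, q)
  | right (p q : MvPolynomial (Fin 2) K) (μ : K) (hμ : μ ≠ 0) (k : ℕ) (hk : 2 ≤ k) :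
      ElementaryStep (p, q) (p, q + μ • p ^ k)

/-- The pair `(p, q)` is elementary reduced: no single admissible transformation lowers the sum
of the degrees. -/
def IsElementaryReduced {K : Type*} [Field K] (p q : MvPolynomial (Fin 2) K) : Prop :=
  ∀ p' q' : MvPolynomial (Fin 2) K, ElementaryStep (p, q) (p', q') →
    p.totalDegree + q.totalDegree ≤ p'.totalDegree + q'.totalDegree

/-! Write w = G(p, q), give x, y the weights n, m, and let T be the top weighted form of G, of
weight W ≥ 2n since w is not affine. Let P, Q be the top forms of p, q. If T(P, Q) ≠ 0, no
cancellation occurs and deg w = W > n. Otherwise let e ≥ 1 be the multiplicity of Q as a root of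
T(P, Y). Then the e-th y-derivative of T does not vanish at (P, Q), so (∂_y^e G)(p, q) has degree at
least W - em. Since D(p, G(p, q)) = (∂_y G)(p, q) · D(p, q), each derivative lowers the degree by at
least deg D + 2 - n; hence deg w ≥ W - e(n + m) + e(deg D + 2). It remains to bound e. The exponents
of Y in T(P, Y) agree modulo n / gcd(n, m), so T(P, Y) is sparse, and in characteristic zero e · m ·
n / gcd(n, m) ≤ W. If n ∤ m this gives e(n + m) ≤ W and deg w > deg D. If n ∣ m, the relation T(P,
Q) = 0 makes Q a multiple of a power of P, against reducedness. -/

/-! ### Multiplicity of nonzero roots of sparse polynomials -/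

section Sparse

variable {R : Type*} [CommRing R] [IsDomain R] [CharZero R]

/-- In characteristic zero, the multiplicity of a nonzero root is less than the number of terms. -/
theorem Polynomial.rootMultiplicity_lt_card_support {f : Polynomial R} (hf : f ≠ 0) {a : R}
    (ha : a ≠ 0) : f.rootMultiplicity a < f.support.card := by
  induction hN : f.natDegree using Nat.strong_induction_on generalizing f with
  | _ N ih =>
  -- A factor X changes neither the multiplicity at a ≠ 0 nor the number of terms. Without such a
  -- factor, differentiation kills the constant term and lowers the multiplicity by at most one.
  by_cases h0 : f.coeff 0 = 0
  · obtain ⟨g, rfl⟩ := Polynomial.X_dvd_iff.2 h0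
    have hg : g ≠ 0 := right_ne_zero_of_mul hf
    have hX : (Polynomial.X : Polynomial R).rootMultiplicity a = 0 :=
      Polynomial.rootMultiplicity_eq_zero (by simpa [Polynomial.IsRoot] using ha)
    have hlt : g.natDegree < N := by
      rw [← hN, Polynomial.natDegree_X_mul hg]; omega
    have := ih _ hlt hg rfl
    rw [Polynomial.rootMultiplicity_mul hf, hX, zero_add]
    refine this.trans_le (Finset.card_le_card_of_injOn (· + 1) ?_ (by simp [Set.InjOn]))
    intro j hj
    simpa using hj
  · by_cases hd : Polynomial.derivative f = 0
    · have hc := Polynomial.derivative_eq_zero.1 hd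
      rw [Polynomial.rootMultiplicity_eq_zero]
      · exact Finset.card_pos.2 (Polynomial.nonempty_support_iff.2 hf)
      · rw [Polynomial.eq_C_of_natDegree_eq_zero hc]
        simpa [Polynomial.IsRoot] using h0
    · have hpos : f.natDegree ≠ 0 := fun h => hd (Polynomial.derivative_of_natDegree_zero h)
      have h1 := ih _ (hN ▸ Polynomial.natDegree_derivative_lt hpos) hd rfl
      have h2 := Polynomial.rootMultiplicity_sub_one_le_derivative_rootMultiplicity f a
      have h3 : (Polynomial.derivative f).support.card ≤ (f.support.erase 0).card := by
        refine Finset.card_le_card_of_injOn (· + 1) ?_ (by simp [Set.InjOn])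
        intro j hj
        have hj' : (Polynomial.derivative f).coeff j ≠ 0 := by simpa using hj
        rw [Polynomial.coeff_derivative] at hj'
        simpa using left_ne_zero_of_mul hj'
      rw [Finset.card_erase_of_mem (by simpa using h0)] at h3
      omega

/-- If all exponents of `f` are congruent modulo `e`, then every nonzero root has multiplicity at
most `f.natDegree / e`. -/
theorem Polynomial.mul_rootMultiplicity_le_natDegree {f : Polynomial R} (hf : f ≠ 0) {a : R}
    (ha : a ≠ 0) {e : ℕ} (he : ∀ i ∈ f.support, ∀ j ∈ f.support, i ≡ j [MOD e]) :
    e * f.rootMultiplicity a ≤ f.natDegree := by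
  rcases Nat.eq_zero_or_pos e with rfl | hpos
  · simp
  have h1 := Polynomial.rootMultiplicity_lt_card_support hf ha
  -- Within one residue class modulo e, an exponent is determined by its quotient by e.
  have h2 : f.support.card ≤ (Finset.range (f.natDegree / e + 1)).card := by
    refine Finset.card_le_card_of_injOn (· / e) ?_ ?_
    · intro j hj
      simpa [Nat.lt_succ_iff] using Nat.div_le_div_right (Polynomial.le_natDegree_of_mem_supp j hj)
    · intro i hi j hj hij
      have := he i hi j hj
      rw [← Nat.div_add_mod i e, ← Nat.div_add_mod j e, show i % e = j % e from this,
        show i / e = j / e from hij]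
  rw [Finset.card_range] at h2
  calc e * f.rootMultiplicity a ≤ e * (f.natDegree / e) := Nat.mul_le_mul_left _ (by omega)
    _ ≤ f.natDegree := Nat.mul_div_le _ _

end Sparse

/-! ### Top homogeneous components -/

section Leading

variable {σ R : Type*} [CommRing R]

theorem MvPolynomial.homogeneousComponent_mul_of_totalDegree_le {f g : MvPolynomial σ R} {a b : ℕ}
    (hf : f.totalDegree ≤ a) (hg : g.totalDegree ≤ b) :
    homogeneousComponent (a + b) (f * g) =
      homogeneousComponent a f * homogeneousComponent b g := by
  classical
  ext d
  rw [coeff_homogeneousComponent]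
  split_ifs with hd
  · rw [coeff_mul, coeff_mul]
    refine Finset.sum_congr rfl fun x hx => ?_
    have hdeg : x.1.degree + x.2.degree = a + b := by
      rw [← hd, ← Finset.HasAntidiagonal.mem_antidiagonal.1 hx, map_add]
    rw [coeff_homogeneousComponent, coeff_homogeneousComponent]
    rcases lt_trichotomy x.1.degree a with h | h | h
    · rw [coeff_eq_zero_of_totalDegree_lt (f := g) (d := x.2)]
      · simp
      · change _ < x.2.degree
        omega
    · rw [if_pos h, if_pos (by omega)]
    · rw [coeff_eq_zero_of_totalDegree_lt (f := f) (d := x.1)]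
      · simp
      · change _ < x.1.degree
        omega
  · have h := (homogeneousComponent_isHomogeneous a f).mul (homogeneousComponent_isHomogeneous b g)
    exact (h.coeff_eq_zero hd).symm

theorem MvPolynomial.homogeneousComponent_pow_of_totalDegree_le {f : MvPolynomial σ R} {a : ℕ}
    (hf : f.totalDegree ≤ a) (j : ℕ) :
    homogeneousComponent (j * a) (f ^ j) = homogeneousComponent a f ^ j := by
  induction j with
  | zero => simp
  | succ j ih =>
    rw [pow_succ, pow_succ, ← ih, add_mul, one_mul,
      homogeneousComponent_mul_of_totalDegree_le _ hf]
    exact (totalDegree_pow f j).trans (Nat.mul_le_mul_left _ hf)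

theorem MvPolynomial.homogeneousComponent_totalDegree_ne_zero {f : MvPolynomial σ R} (hf : f ≠ 0) :
    homogeneousComponent f.totalDegree f ≠ 0 := by
  obtain ⟨s, hs, hs'⟩ := Finset.exists_mem_eq_sup f.support (support_nonempty.2 hf)
    fun s => s.sum fun _ e => e
  intro h
  have := congrArg (coeff s) h
  rw [coeff_homogeneousComponent, if_pos, coeff_zero] at this
  · exact mem_support_iff.1 hs this
  · exact hs'.symm

theorem MvPolynomial.totalDegree_lt_of_homogeneousComponent_eq_zero {f : MvPolynomial σ R} {a : ℕ}
    (ha : 0 < a) (hf : f.totalDegree ≤ a) (h : homogeneousComponent a f = 0) :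
    f.totalDegree < a := by
  refine lt_of_le_of_ne hf fun he => ?_
  by_cases h0 : f = 0
  · simp [h0] at he; omega
  · exact homogeneousComponent_totalDegree_ne_zero h0 (he ▸ h)

theorem MvPolynomial.totalDegree_pderiv_le (i : σ) (f : MvPolynomial σ R) :
    (pderiv i f).totalDegree ≤ f.totalDegree - 1 := by
  classical
  refine Finset.sup_le fun s hs => ?_
  rw [mem_support_iff, coeff_pderiv] at hs
  have h := le_totalDegree (mem_support_iff.2 (left_ne_zero_of_mul hs))
  change (s + Finsupp.single i 1).degree ≤ _ at h
  change s.degree ≤ _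
  rw [map_add, Finsupp.degree_single] at h
  omega

end Leading

/-! ### Polynomials in two variables with weights -/

section Weighted

variable {K : Type*} [Field K]

theorem weight_fin_two (n m : ℕ) (s : Fin 2 →₀ ℕ) :
    Finsupp.weight ![n, m] s = s 0 * n + s 1 * m := by
  rw [Finsupp.weight_apply, Finsupp.sum_fintype _ _ (by simp)]
  simp [Fin.sum_univ_two]

/-- If all monomials of `G` have weight at most `W`, then the degree `W` part of `G(p, q)` is the
weight `W` part of `G` evaluated at the top forms of `p` and `q`. -/
theorem homogeneousComponent_aeval {p q : MvPolynomial (Fin 2) K} {n m W : ℕ}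
    (hp : p.totalDegree ≤ n) (hq : q.totalDegree ≤ m) {G : MvPolynomial (Fin 2) K}
    (hG : ∀ s ∈ G.support, Finsupp.weight ![n, m] s ≤ W) :
    homogeneousComponent W (aeval ![p, q] G) =
      aeval ![homogeneousComponent n p, homogeneousComponent m q]
        (weightedHomogeneousComponent ![n, m] W G) := by
  classical
  rw [weightedHomogeneousComponent_apply, map_sum, Finset.sum_filter, aeval_def, eval₂_eq',
    map_sum]
  refine Finset.sum_congr rfl fun s hs => ?_
  rw [aeval_monomial, algebraMap_eq, homogeneousComponent_C_mul,
    Finsupp.prod_fintype _ _ (by simp)]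
  simp only [Fin.prod_univ_two, Matrix.cons_val_zero, Matrix.cons_val_one]
  have hp' : (p ^ s 0).totalDegree ≤ s 0 * n :=
    (totalDegree_pow p _).trans (Nat.mul_le_mul_left _ hp)
  have hq' : (q ^ s 1).totalDegree ≤ s 1 * m :=
    (totalDegree_pow q _).trans (Nat.mul_le_mul_left _ hq)
  have hsW := hG s hs
  rw [weight_fin_two] at hsW ⊢
  split_ifs with h
  · rw [← h, homogeneousComponent_mul_of_totalDegree_le hp' hq',
      homogeneousComponent_pow_of_totalDegree_le hp, homogeneousComponent_pow_of_totalDegree_le hq]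
  · rw [homogeneousComponent_eq_zero, mul_zero]
    have := totalDegree_mul (p ^ s 0) (q ^ s 1)
    omega

theorem weightedHomogeneousComponent_pderiv_one (n m V : ℕ) (G : MvPolynomial (Fin 2) K) :
    weightedHomogeneousComponent ![n, m] V (pderiv 1 G) =
      pderiv 1 (weightedHomogeneousComponent ![n, m] (V + m) G) := by
  classical
  ext s
  simp only [coeff_weightedHomogeneousComponent, coeff_pderiv, weight_fin_two]
  simp [add_mul, ← add_assoc]

theorem weightedHomogeneousComponent_iterate_pderiv_one (n m V k : ℕ)
    (G : MvPolynomial (Fin 2) K) :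
    weightedHomogeneousComponent ![n, m] V ((pderiv 1)^[k] G) =
      (pderiv 1)^[k] (weightedHomogeneousComponent ![n, m] (V + k * m) G) := by
  induction k generalizing G with
  | zero => simp
  | succ k ih =>
    rw [Function.iterate_succ_apply, Function.iterate_succ_apply, ih,
      weightedHomogeneousComponent_pderiv_one, add_mul, one_mul, add_assoc]

theorem weight_le_of_mem_support_iterate_pderiv_one {n m V k : ℕ} {G : MvPolynomial (Fin 2) K}
    (hG : ∀ s ∈ G.support, Finsupp.weight ![n, m] s ≤ V + k * m) :
    ∀ s ∈ ((pderiv 1)^[k] G).support, Finsupp.weight ![n, m] s ≤ V := by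
  classical
  induction k generalizing G with
  | zero => simpa using hG
  | succ k ih =>
    rw [Function.iterate_succ_apply]
    refine ih fun s hs => ?_
    rw [mem_support_iff, coeff_pderiv] at hs
    have h := hG _ (mem_support_iff.2 (left_ne_zero_of_mul hs))
    rw [weight_fin_two] at h ⊢
    simp [add_mul] at h
    omega

variable {A : Type*} [CommRing A] [Algebra K A]

/-- Partial evaluation at a constant in the first variable turns `∂/∂y` into the derivative. -/
theorem derivative_aeval_C_X (u : A) (G : MvPolynomial (Fin 2) K) :
    Polynomial.derivative (aeval ![Polynomial.C u, Polynomial.X] G) =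
      aeval ![Polynomial.C u, Polynomial.X] (pderiv 1 G) := by
  induction G using MvPolynomial.induction_on with
  | C a => simp [Polynomial.algebraMap_apply]
  | add f g hf hg => simp [hf, hg]
  | mul_X f i hf => fin_cases i <;> simp [hf, mul_comm]

theorem iterate_derivative_aeval_C_X (u : A) (k : ℕ) (G : MvPolynomial (Fin 2) K) :
    Polynomial.derivative^[k] (aeval ![Polynomial.C u, Polynomial.X] G) =
      aeval ![Polynomial.C u, Polynomial.X] ((pderiv 1)^[k] G) := by
  induction k generalizing G with
  | zero => simp
  | succ k ih =>
    rw [Function.iterate_succ_apply, Function.iterate_succ_apply, derivative_aeval_C_X, ih]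

theorem eval_aeval_C_X (u v : A) (G : MvPolynomial (Fin 2) K) :
    (aeval ![Polynomial.C u, Polynomial.X] G : Polynomial A).eval v = aeval ![u, v] G := by
  induction G using MvPolynomial.induction_on with
  | C a => simp [Polynomial.algebraMap_apply]
  | add f g hf hg => simp [hf, hg]
  | mul_X f i hf => fin_cases i <;> simp [hf]

theorem coeff_aeval_C_X (u : A) (G : MvPolynomial (Fin 2) K) (j : ℕ) :
    (aeval ![Polynomial.C u, Polynomial.X] G : Polynomial A).coeff j =
      ∑ s ∈ G.support, if s 1 = j then algebraMap K A (coeff s G) * u ^ s 0 else 0 := by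
  rw [aeval_def, eval₂_eq', Polynomial.finsetSum_coeff]
  refine Finset.sum_congr rfl fun s _ => ?_
  simp only [Fin.prod_univ_two, Matrix.cons_val_zero, Matrix.cons_val_one,
    Polynomial.algebraMap_apply]
  rw [← mul_assoc, ← Polynomial.C_pow, ← Polynomial.C_mul, Polynomial.coeff_C_mul,
    Polynomial.coeff_X_pow]
  simp [eq_comm]

theorem exists_mem_support_of_coeff_aeval_C_X_ne_zero {u : A} {G : MvPolynomial (Fin 2) K} {j : ℕ}
    (h : (aeval ![Polynomial.C u, Polynomial.X] G : Polynomial A).coeff j ≠ 0) :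
    ∃ s ∈ G.support, s 1 = j := by
  rw [coeff_aeval_C_X] at h
  obtain ⟨s, hs, hne⟩ := Finset.exists_ne_zero_of_sum_ne_zero h
  exact ⟨s, hs, by by_contra hc; simp [hc] at hne⟩

variable [IsDomain A]

/-- For fixed weight the exponent of y determines that of x, as n > 0, so distinct monomials of G
cannot cancel. -/
theorem aeval_C_X_ne_zero {u : A} (hu : u ≠ 0) {n m W : ℕ} (hn : 0 < n)
    {G : MvPolynomial (Fin 2) K} (hG : G ≠ 0) (hGW : IsWeightedHomogeneous ![n, m] G W) :
    (aeval ![Polynomial.C u, Polynomial.X] G : Polynomial A) ≠ 0 := by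
  obtain ⟨s, hs⟩ := support_nonempty.2 hG
  intro h0
  have h := congrArg (fun f => Polynomial.coeff f (s 1)) h0
  simp only [coeff_aeval_C_X, Polynomial.coeff_zero] at h
  rw [Finset.sum_eq_single s] at h
  · rw [if_pos rfl] at h
    refine mul_ne_zero ?_ (pow_ne_zero _ hu) h
    simpa using hs
  · intro t ht hts
    refine if_neg fun h1 => hts ?_
    have hs' := hGW (mem_support_iff.1 hs)
    have ht' := hGW (mem_support_iff.1 ht)
    rw [weight_fin_two] at hs' ht'
    have h0 : t 0 = s 0 := Nat.eq_of_mul_eq_mul_right hn (by rw [h1] at ht'; omega)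
    ext i
    fin_cases i
    · exact h0
    · exact h1
  · exact fun h => absurd hs h

/-- The multiplicity of `v` as a root of `G(u, Y)`, for `G` weighted homogeneous. -/
theorem weight_mul_rootMultiplicity_le [CharZero A] {u v : A} (hu : u ≠ 0) (hv : v ≠ 0)
    {n m W : ℕ} (hn : 0 < n) {G : MvPolynomial (Fin 2) K} (hG : G ≠ 0)
    (hGW : IsWeightedHomogeneous ![n, m] G W) :
    m * (n / n.gcd m *
      (aeval ![Polynomial.C u, Polynomial.X] G : Polynomial A).rootMultiplicity v) ≤ W := by
  have hf := aeval_C_X_ne_zero (A := A) hu hn hG hGW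
  set f : Polynomial A := aeval ![Polynomial.C u, Polynomial.X] G with hfdef
  have hwt : ∀ j ∈ f.support, ∃ i, i * n + j * m = W := by
    intro j hj
    obtain ⟨s, hs, rfl⟩ :=
      exists_mem_support_of_coeff_aeval_C_X_ne_zero (Polynomial.mem_support_iff.1 hj)
    exact ⟨s 0, by rw [← weight_fin_two]; exact hGW (mem_support_iff.1 hs)⟩
  have hmul := Polynomial.mul_rootMultiplicity_le_natDegree hf hv (e := n / n.gcd m) (by
    intro i hi j hj
    obtain ⟨a, ha⟩ := hwt i hi
    obtain ⟨b, hb⟩ := hwt j hj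
    refine Nat.ModEq.cancel_left_div_gcd hn (c := m) ?_
    have h1 : a * n + i * m ≡ b * n + j * m [MOD n] := by rw [ha, hb]
    have h2 : ∀ c d : ℕ, c * n + d * m ≡ m * d [MOD n] := by
      intro c d
      rw [mul_comm d m]
      simp [Nat.ModEq]
    exact (h2 a i).symm.trans (h1.trans (h2 b j)))
  obtain ⟨i, hi⟩ := hwt _ (Polynomial.natDegree_mem_support_of_nonzero hf)
  calc _ ≤ m * f.natDegree := Nat.mul_le_mul_left _ hmul
    _ ≤ W := by rw [mul_comm]; omega

/-- Over an algebraically closed field, a weighted homogeneous relation between `P` and `Q` for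
the weights `n` and `n * c` forces `Q` to be a multiple of `P ^ c`. -/
theorem exists_eq_smul_pow_of_aeval_eq_zero [IsAlgClosed K] {P Q : A} (hP : P ≠ 0)
    {n c W : ℕ} (hn : 0 < n) {G : MvPolynomial (Fin 2) K} (hG : G ≠ 0)
    (hGW : IsWeightedHomogeneous ![n, n * c] G W) (h0 : aeval ![P, Q] G = 0) :
    ∃ α : K, Q = α • P ^ c := by
  -- In the fraction field, Q / P ^ c is a root of G(1, Y), a nonzero polynomial over K; it is
  -- therefore algebraic over K and lies in K.
  let F := FractionRing A
  have hinj : Function.Injective (algebraMap A F) := IsFractionRing.injective A F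
  set x : F := algebraMap A F P with hx
  set y : F := algebraMap A F Q with hy
  have hx0 : x ≠ 0 := by simpa [hx] using hP
  set g : Polynomial K := aeval ![Polynomial.C 1, Polynomial.X] G with hg
  have hg0 : g ≠ 0 := aeval_C_X_ne_zero one_ne_zero hn hG hGW
  have hxy : aeval ![x, y] G = 0 := by
    have := congrArg (algebraMap A F) h0
    rw [map_zero, ← aeval_algebraMap_apply] at this
    rw [← this]
    congr 2
    ext i
    fin_cases i <;> rfl
  have hgr : Polynomial.aeval (y / x ^ c) g = aeval ![(1 : F), y / x ^ c] G := by
    rw [hg, ← AlgHom.comp_apply]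
    congr 1
    ext i
    fin_cases i <;> simp
  have hscale : x ^ (W / n) * aeval ![(1 : F), y / x ^ c] G = aeval ![x, y] G := by
    rw [aeval_def, aeval_def, eval₂_eq', eval₂_eq', Finset.mul_sum]
    refine Finset.sum_congr rfl fun s hs => ?_
    have hs' := hGW (mem_support_iff.1 hs)
    rw [weight_fin_two] at hs'
    have hW : W / n = s 0 + s 1 * c := by
      rw [← hs']
      refine Nat.div_eq_of_eq_mul_left hn (by ring)
    simp only [Fin.prod_univ_two, Matrix.cons_val_zero, Matrix.cons_val_one, hW]
    have hxc : (x ^ c) ^ s 1 ≠ 0 := pow_ne_zero _ (pow_ne_zero _ hx0)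
    rw [one_pow, one_mul, div_pow, pow_add, mul_comm (s 1) c, pow_mul, mul_div_assoc', mul_div_assoc',
      div_eq_iff hxc]
    ring
  have halg : IsAlgebraic K (y / x ^ c) := by
    refine ⟨g, hg0, ?_⟩
    rw [hgr]
    exact (mul_eq_zero.1 (hscale.trans hxy)).resolve_left (pow_ne_zero _ hx0)
  obtain ⟨α, hα⟩ := minpoly.mem_range_of_degree_eq_one K (y / x ^ c)
    (IsAlgClosed.degree_eq_one_of_irreducible K (minpoly.irreducible halg.isIntegral))
  refine ⟨α, hinj ?_⟩
  rw [Algebra.smul_def, map_mul, map_pow, ← IsScalarTower.algebraMap_apply, hα]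
  exact (div_mul_cancel₀ y (pow_ne_zero _ hx0)).symm

end Weighted

/-! ### Degrees of elements of `K[p, q]` and the Jacobian -/

section Jacobian

variable {K : Type*} [Field K]

theorem jacobianDet_eq (p q : MvPolynomial (Fin 2) K) :
    jacobianDet p q = pderiv 0 p * pderiv 1 q - pderiv 1 p * pderiv 0 q := by
  simp [jacobianDet, Matrix.det_fin_two]

theorem pderiv_aeval_fin_two (p q H : MvPolynomial (Fin 2) K) (i : Fin 2) :
    pderiv i (aeval ![p, q] H) =
      aeval ![p, q] (pderiv 0 H) * pderiv i p + aeval ![p, q] (pderiv 1 H) * pderiv i q := by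
  induction H using MvPolynomial.induction_on with
  | C a => simp [algebraMap_eq]
  | add f g hf hg => simp only [map_add, hf, hg]; ring
  | mul_X f j hf =>
    simp only [map_mul, Derivation.leibniz, hf, aeval_X, map_add, smul_eq_mul]
    fin_cases j <;> simp <;> ring

/-- Chain rule: the ∂/∂x part of H contributes a multiple of D(p, p) = 0. -/
theorem jacobianDet_aeval (p q H : MvPolynomial (Fin 2) K) :
    jacobianDet p (aeval ![p, q] H) = aeval ![p, q] (pderiv 1 H) * jacobianDet p q := by
  simp only [jacobianDet_eq, pderiv_aeval_fin_two]
  ring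

/-- Each partial derivative lowers the degree by at least one. Nonvanishing of D excludes constant p
or q, where the truncated `- 1` would gain nothing. -/
theorem totalDegree_jacobianDet_add_two_le {p q : MvPolynomial (Fin 2) K}
    (h : jacobianDet p q ≠ 0) :
    (jacobianDet p q).totalDegree + 2 ≤ p.totalDegree + q.totalDegree := by
  have hp : p.totalDegree ≠ 0 := fun hp => h <| by
    rw [totalDegree_eq_zero_iff_eq_C.1 hp]; simp [jacobianDet_eq]
  have hq : q.totalDegree ≠ 0 := fun hq => h <| by
    rw [totalDegree_eq_zero_iff_eq_C.1 hq]; simp [jacobianDet_eq]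
  have h1 := totalDegree_sub (pderiv 0 p * pderiv 1 q) (pderiv 1 p * pderiv 0 q)
  have h2 := totalDegree_mul (pderiv 0 p) (pderiv 1 q)
  have h3 := totalDegree_mul (pderiv 1 p) (pderiv 0 q)
  have h4 := totalDegree_pderiv_le 0 p
  have h5 := totalDegree_pderiv_le 1 p
  have h6 := totalDegree_pderiv_le 0 q
  have h7 := totalDegree_pderiv_le 1 q
  rw [← jacobianDet_eq] at h1
  omega

theorem totalDegree_aeval_iterate_pderiv_add_le {p q : MvPolynomial (Fin 2) K}
    (hind : AlgebraicIndependent K ![p, q]) (hD : jacobianDet p q ≠ 0) {k : ℕ}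
    {G : MvPolynomial (Fin 2) K} (hG : (pderiv 1)^[k] G ≠ 0) :
    (aeval ![p, q] ((pderiv 1)^[k] G)).totalDegree + k * ((jacobianDet p q).totalDegree + 2) ≤
      (aeval ![p, q] G).totalDegree + k * p.totalDegree := by
  induction k generalizing G with
  | zero => simp
  | succ k ih =>
    rw [Function.iterate_succ_apply] at hG ⊢
    have h1 := ih hG
    have hG' : pderiv 1 G ≠ 0 := fun h => hG (by rw [h, iterate_map_zero])
    have hne : aeval ![p, q] (pderiv 1 G) ≠ 0 := fun h => hG' (hind (by rw [h, map_zero]))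
    have h2 := totalDegree_jacobianDet_add_two_le (p := p) (q := aeval ![p, q] G)
      (by rw [jacobianDet_aeval]; exact mul_ne_zero hne hD)
    rw [jacobianDet_aeval, totalDegree_mul_of_isDomain hne hD] at h2
    rw [add_mul, add_mul, one_mul, one_mul]
    omega

/-- The degree estimate: if the weighted top form of `G` has weight `W`, then there is a
multiplicity `k` with `k * lcm (n, m) ≤ W` such that `deg G(p, q)` is at least
`W - k * (n + m - 2 - deg D(p, q))`; moreover `k = 0` unless the top form of `G` vanishes at the
top forms of `p` and `q`. -/
theorem exists_multiplicity_totalDegree_aeval [CharZero K] {p q : MvPolynomial (Fin 2) K}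
    (hind : AlgebraicIndependent K ![p, q]) (hD : jacobianDet p q ≠ 0)
    {n m W : ℕ} (hp : p.totalDegree = n) (hq : q.totalDegree = m) (hn : 0 < n)
    {G : MvPolynomial (Fin 2) K} (hG : ∀ s ∈ G.support, Finsupp.weight ![n, m] s ≤ W)
    (hGW : weightedHomogeneousComponent ![n, m] W G ≠ 0) :
    ∃ k : ℕ, m * (n / n.gcd m * k) ≤ W ∧
      W + k * ((jacobianDet p q).totalDegree + 2) ≤ (aeval ![p, q] G).totalDegree + k * (n + m) ∧
      (k ≠ 0 → aeval ![homogeneousComponent n p, homogeneousComponent m q]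
        (weightedHomogeneousComponent ![n, m] W G) = 0) := by
  have hp0 : p ≠ 0 := hind.ne_zero 0
  have hq0 : q ≠ 0 := hind.ne_zero 1
  set P := homogeneousComponent n p with hPdef
  set Q := homogeneousComponent m q with hQdef
  have hP : P ≠ 0 := by
    rw [hPdef, ← hp]; exact homogeneousComponent_totalDegree_ne_zero hp0
  have hQ : Q ≠ 0 := by
    rw [hQdef, ← hq]; exact homogeneousComponent_totalDegree_ne_zero hq0
  set T := weightedHomogeneousComponent ![n, m] W G with hT
  have hTW : IsWeightedHomogeneous ![n, m] T W :=
    weightedHomogeneousComponent_isWeightedHomogeneous W G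
  set f : Polynomial (MvPolynomial (Fin 2) K) :=
    aeval ![Polynomial.C P, Polynomial.X] T with hf
  have hf0 : f ≠ 0 := aeval_C_X_ne_zero hP hn hGW hTW
  have hle := weight_mul_rootMultiplicity_le hP hQ hn hGW hTW
  refine ⟨f.rootMultiplicity Q, hle, ?_, fun hk => ?_⟩
  · set k := f.rootMultiplicity Q with hk
    -- In characteristic zero, vanishing of all derivatives up to order k would force multiplicity
    -- above k.
    have hroot : (Polynomial.derivative^[k] f).eval Q ≠ 0 := by
      intro h
      refine lt_irrefl k ((Polynomial.lt_rootMultiplicity_iff_isRoot_iterate_derivative hf0).2 ?_)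
      intro j hj
      rcases hj.lt_or_eq with hj | rfl
      · exact Polynomial.isRoot_iterate_derivative_of_lt_rootMultiplicity hj
      · exact h
    rw [hf, iterate_derivative_aeval_C_X, eval_aeval_C_X] at hroot
    have he : 1 ≤ n / n.gcd m :=
      Nat.div_pos (Nat.gcd_le_left _ hn) (Nat.gcd_pos_of_pos_left _ hn)
    have hkm : k * m ≤ W := by
      refine le_trans ?_ hle
      rw [mul_comm]
      exact Nat.mul_le_mul_left _ (Nat.le_mul_of_pos_left _ he)
    obtain ⟨V, hWV⟩ := Nat.exists_eq_add_of_le' hkm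
    have hiter := weightedHomogeneousComponent_iterate_pderiv_one n m V k G
    rw [← hWV, ← hT] at hiter
    rw [← hiter, hPdef, hQdef, ← homogeneousComponent_aeval hp.le hq.le
      (weight_le_of_mem_support_iterate_pderiv_one (hWV ▸ hG))] at hroot
    have hV : V ≤ (aeval ![p, q] ((pderiv 1)^[k] G)).totalDegree := by
      by_contra hlt
      exact hroot (homogeneousComponent_eq_zero _ _ (not_le.1 hlt))
    have hne : (pderiv 1)^[k] G ≠ 0 := fun h => hroot (by rw [h]; simp)
    have := totalDegree_aeval_iterate_pderiv_add_le hind hD hne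
    rw [hp] at this
    rw [mul_add k n m]
    omega
  · have := (Polynomial.rootMultiplicity_pos hf0).1 (Nat.pos_of_ne_zero hk)
    rwa [Polynomial.IsRoot, hf, eval_aeval_C_X] at this

/-- A polynomial all of whose monomials have weight less than `2 * n` is affine. -/
theorem aeval_eq_affine_of_weight_lt {p q : MvPolynomial (Fin 2) K} {n m : ℕ} (hnm : n < m)
    {G : MvPolynomial (Fin 2) K} (hG : ∀ s ∈ G.support, Finsupp.weight ![n, m] s < 2 * n) :
    ∃ a b c : K, aeval ![p, q] G = a • p + b • q + C c := by
  classical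
  -- As n < m, each of x², xy and y² already has weight at least 2n.
  have hsub : G.support ⊆ {Finsupp.single 0 1, Finsupp.single 1 1, 0} := by
    intro s hs
    have h := hG s hs
    rw [weight_fin_two] at h
    have h0 : s 0 < 2 := by by_contra! h0; nlinarith
    have h1 : s 1 < 2 := by by_contra! h1; nlinarith
    have h01 : ¬ (s 0 = 1 ∧ s 1 = 1) := by rintro ⟨h0, h1⟩; rw [h0, h1] at h; omega
    simp only [Finset.mem_insert, Finset.mem_singleton, Finsupp.ext_iff, Fin.forall_fin_two]
    simp
    omega
  refine ⟨coeff (Finsupp.single 0 1) G, coeff (Finsupp.single 1 1) G, coeff 0 G, ?_⟩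
  rw [aeval_def, eval₂_eq', Finset.sum_subset hsub]
  · rw [Finset.sum_insert, Finset.sum_insert, Finset.sum_singleton]
    · simp [algebraMap_eq, smul_eq_C_mul, add_assoc]
    · simp
    · simp [Finsupp.single_left_inj]
  · intro s _ hs
    rw [notMem_support_iff.1 hs]; simp

/-- Otherwise subtracting α p ^ c from q would cancel its top form and lower the degree sum. -/
theorem IsElementaryReduced.homogeneousComponent_ne_smul_pow {p q : MvPolynomial (Fin 2) K}
    (hred : IsElementaryReduced p q) (hq : 0 < q.totalDegree) {c : ℕ} (hc : 2 ≤ c)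
    (hpq : q.totalDegree = c * p.totalDegree) (α : K) :
    homogeneousComponent q.totalDegree q ≠
      α • homogeneousComponent p.totalDegree p ^ c := by
  intro h
  have hq0 : q ≠ 0 := by rintro rfl; simp at hq
  have hα : α ≠ 0 := by
    rintro rfl
    rw [zero_smul] at h
    exact homogeneousComponent_totalDegree_ne_zero hq0 h
  have hle := hred _ _ (ElementaryStep.right p q (-α) (neg_ne_zero.2 hα) c hc)
  have hlt : (q + (-α) • p ^ c).totalDegree < q.totalDegree := by
    refine totalDegree_lt_of_homogeneousComponent_eq_zero hq ?_ ?_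
    · refine (totalDegree_add _ _).trans (max_le le_rfl ?_)
      exact ((totalDegree_smul_le _ _).trans (totalDegree_pow p c)).trans hpq.ge
    · rw [map_add, map_smul, h]
      rw [hpq, homogeneousComponent_pow_of_totalDegree_le le_rfl]
      simp
  omega

end Jacobian

theorem mainTheorem5 (p q : MvPolynomial (Fin 2) ℂ)
    (hind : AlgebraicIndependent ℂ ![p, q])
    (hred : IsElementaryReduced p q)
    (n m k : ℕ) (hn : p.totalDegree = n) (hm : q.totalDegree = m)
    (hn2 : 2 ≤ n) (hnm : n < m)
    (hk : k ≤ (jacobianDet p q).totalDegree)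
    (w : MvPolynomial (Fin 2) ℂ)
    (hw : w ∈ Algebra.adjoin ℂ ({p, q} : Set (MvPolynomial (Fin 2) ℂ)))
    (hlin : ¬ ∃ a b c : ℂ, w = a • p + b • q + MvPolynomial.C c) :
    min n k < w.totalDegree := by
  -- The zero polynomial has `totalDegree` 0, so here k = 0 and it suffices that w is not constant.
  by_cases hD : jacobianDet p q = 0
  · rw [hD, totalDegree_zero] at hk
    refine (min_le_right n k).trans_lt (lt_of_le_of_lt hk (Nat.pos_of_ne_zero fun h => hlin ?_))
    exact ⟨0, 0, coeff 0 w, by simpa using totalDegree_eq_zero_iff_eq_C.1 h⟩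
  have hrange : ({p, q} : Set (MvPolynomial (Fin 2) ℂ)) = Set.range ![p, q] := by
    simp [Set.pair_comm]
  rw [hrange, Algebra.adjoin_range_eq_range_aeval] at hw
  obtain ⟨G, rfl⟩ := hw
  change min n k < (aeval ![p, q] G).totalDegree
  obtain ⟨t, ht, htn⟩ : ∃ t ∈ G.support, 2 * n ≤ Finsupp.weight ![n, m] t := by
    by_contra! h
    exact hlin (aeval_eq_affine_of_weight_lt hnm h)
  obtain ⟨s, hs, hmax⟩ := G.support.exists_max_image (Finsupp.weight ![n, m]) ⟨t, ht⟩
  set W := Finsupp.weight ![n, m] s with hW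
  have hW2 : 2 * n ≤ W := htn.trans (hmax t ht)
  have hT : weightedHomogeneousComponent ![n, m] W G ≠ 0 := by
    classical
    intro h
    have := congrArg (coeff s) h
    rw [coeff_weightedHomogeneousComponent, if_pos hW.symm, coeff_zero] at this
    exact mem_support_iff.1 hs this
  obtain ⟨e, he1, he2, he3⟩ :=
    exists_multiplicity_totalDegree_aeval hind hD hn hm (by omega) hmax hT
  rcases Nat.eq_zero_or_pos e with rfl | hpos
  · refine (min_le_left n k).trans_lt ?_
    omega
  refine (min_le_right n k).trans_lt (hk.trans_lt ?_)
  by_cases hdvd : n ∣ m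
  · exfalso
    obtain ⟨c, rfl⟩ := hdvd
    have hc : 2 ≤ c := by
      by_contra! hc
      interval_cases c <;> omega
    obtain ⟨α, hα⟩ := exists_eq_smul_pow_of_aeval_eq_zero
      (hn ▸ homogeneousComponent_totalDegree_ne_zero (hind.ne_zero 0)) (by omega) hT
      (weightedHomogeneousComponent_isWeightedHomogeneous W G) (he3 hpos.ne')
    refine hred.homogeneousComponent_ne_smul_pow (by omega) hc (by rw [hm, hn, mul_comm]) α ?_
    rw [hm, hn, hα]
  · have h2 : 2 ≤ n / n.gcd m := by
      obtain ⟨d, hd⟩ := Nat.gcd_dvd_left n m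
      have hg : 0 < n.gcd m := Nat.gcd_pos_of_pos_left _ (by omega)
      rw [Nat.div_eq_of_eq_mul_right hg hd]
      by_contra! hlt
      interval_cases d
      · omega
      · exact hdvd (by rw [hd, mul_one]; exact Nat.gcd_dvd_right n m)
    -- The loss e(n + m) is at most 2em, which the multiplicity bound with n / gcd(n, m) ≥ 2 absorbs
    -- into W.
    have h3 : e * (n + m) ≤ W := by
      refine le_trans ?_ he1
      calc e * (n + m) ≤ e * (m * 2) := Nat.mul_le_mul_left _ (by omega)
        _ = m * (2 * e) := by ring
        _ ≤ _ := Nat.mul_le_mul_left _ (Nat.mul_le_mul_right _ h2)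
    have h4 : (jacobianDet p q).totalDegree + 2 ≤ e * ((jacobianDet p q).totalDegree + 2) :=
      Nat.le_mul_of_pos_left _ hpos
    omega
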